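/- **Proposition 4.1.** Let $(p_k)_{k\ge 1}$ be a probability distribution on $\{1,2,\ldots\}$ with $p_k>0$ for infinitely many $k$, and assume that the sequence $(p_k)$ is eventually nonincreasing. For $x>0$ put $\rho(x):=\#\{k\ge 1: p_k\ge 1/x\}$. A function is called slowly varying (at $\infty$) if it is measurable, positive near $\infty$, and $L(cx)/L(x)\to 1$ as $x\to\infty$ for every $c>0$. A de Bruijn conjugate $L^\#$ of a slowly varying function $L$ is a slowly varying function such that $L(x)L^\#(xL(x))\to1$ and $L^\#(x)L(xL^\#(x))\to 1$ as $x\to\infty$ (it is unique up to asymptotic equivalence). Below, $\sim$ means that the ratio of the two sides tends to $1$. (a) If, for some $b>0$ and some slowly varying $L$, $$-\log p_{\lfloor x\rfloor}\sim x^{1/b}L(x^{1/b}),\quad x\to\infty,$$ then $$\rho(x)\sim(\log x)^b\,(L^\#(\log x))^b,\quad x\to\infty.$$ In particular, let $\beta\ge 0$, let $\ell$ be slowly varying, and put $\ell_0(x):=(\ell(x)/(\beta+1))^{1/(\beta+1)}$. If $$-\log p_{\lfloor x\rfloor}\sim x^{1/(\beta+1)}\,\ell_0^\#(x^{1/(\beta+1)}),\quad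 x\to\infty,\tag{1}$$ then $$\rho(x)\sim(\beta+1)^{-1}(\log x)^{\beta+1}\ell(\log x),\quad x\to\infty.$$ (b) Let $\beta\ge 0$, let $\ell$ be slowly varying, and put $s(x):=1/p_{\lfloor x\rfloor}$ for $x\ge1$. Assume that (1) holds, that for all $u\in\mathbb R$ $$\lim_{t\to\infty}\frac{s(t+ug(t))}{s(t)}=e^u,$$ where $g$ is a nonnegative measurable function with $$g(t)\sim(\beta+1)^{\beta/(\beta+1)}\,t^{\beta/(\beta+1)}\,\big(\ell(t^{1/(\beta+1)})\big)^{1/(\beta+1)},\quad t\to\infty,$$ and that $$\ell\big(t(\ell(t))^{1/(\beta+1)}\big)\sim\ell(t),\quad t\to\infty.$$ Then, for all $\lambda>0$, $$\lim_{t\to\infty}\frac{\rho(\lambda t)-\rho(t)}{(\log t)^\beta\,\ell(\log t)}=\log\lambda.$$ -/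

import Mathlib

open Filter Topology Asymptotics

noncomputable section

/-- A probability distribution `p 1, p 2, …` on the positive integers with `p k > 0` for infinitely
many `k`. The sequence is indexed by `k ≥ 1`; the value `p 0` is never used. -/
structure IsBoxDistribution (p : ℕ → ℝ) : Prop where
  nonneg : ∀ k, 1 ≤ k → 0 ≤ p k
  hasSum : HasSum (fun k : ℕ => p (k + 1)) 1
  infinite_pos : {k : ℕ | 1 ≤ k ∧ 0 < p k}.Infinite

/-- The sequence `p` is eventually nonincreasing. -/
def EventuallyNonincreasing (p : ℕ → ℝ) : Prop :=
  ∃ N : ℕ, ∀ k, N ≤ k → p (k + 1) ≤ p k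

/-- The counting function `ρ(x) = #{k ≥ 1 : p k ≥ 1/x}`. -/
def countingFn (p : ℕ → ℝ) (x : ℝ) : ℝ :=
  (({k : ℕ | 1 ≤ k ∧ 1 / x ≤ p k}.ncard : ℕ) : ℝ)

/-- The function `x ↦ -log p_{⌊x⌋}`. -/
def negLogFloor (p : ℕ → ℝ) (x : ℝ) : ℝ :=
  -Real.log (p ⌊x⌋₊)

/-- The function `s(x) = 1 / p_{⌊x⌋}`. -/
def invFloor (p : ℕ → ℝ) (x : ℝ) : ℝ :=
  1 / p ⌊x⌋₊

/-- `L` is slowly varying at infinity: measurable, positive near infinity, and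
`L (c x) / L x → 1` for every `c > 0`. Values of `L` away from infinity are irrelevant. -/
structure IsSlowlyVarying (L : ℝ → ℝ) : Prop where
  measurable : Measurable L
  eventually_pos : ∀ᶠ x in atTop, 0 < L x
  tendsto_ratio : ∀ c : ℝ, 0 < c → Tendsto (fun x => L (c * x) / L x) atTop (𝓝 1)

/-- `M` is a de Bruijn conjugate of the slowly varying function `L` (such an `M` is unique up to
asymptotic equivalence). -/
structure IsDeBruijnConjugate (L M : ℝ → ℝ) : Prop where
  slowlyVarying : IsSlowlyVarying M
  tendsto_left : Tendsto (fun x => L x * M (x * L x)) atTop (𝓝 1)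
  tendsto_right : Tendsto (fun x => M x * L (x * M x)) atTop (𝓝 1)

/-- The function `ℓ₀(x) = (ℓ(x) / (β + 1)) ^ (1 / (β + 1))`. -/
def ellZero (β : ℝ) (ℓ : ℝ → ℝ) (x : ℝ) : ℝ :=
  (ℓ x / (β + 1)) ^ (1 / (β + 1))

end

/-! Up to an additive constant, `countingFn p` is a generalized inverse `n` of the step function `k
↦ 1 / p k`, so both claims are inversion statements. In (a), `y * Lc y` asymptotically inverts `x *
L x`. Hence `-log p` at index `(c * log x * Lc (log x)) ^ b` is about `c * log x`, and letting `c →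
1` from both sides traps `n x` (`countingFn_isEquivalent`). In (b), moving the index by `u * g`
multiplies `1 / p` by about `exp u`, so multiplying `x` by `c` moves `n` by about `log c * g (n x)`
(`tendsto_inverse_increment_div`). Part (a) and the self-similarity of `ℓ` then evaluate `g (n x)`
(`isEquivalent_auxiliary_comp`). -/

/-! ### Slowly varying functions. -/

open MeasureTheory in
/-- Uniform convergence theorem for slowly varying functions, in additive form. -/
theorem eventually_forall_abs_sub_lt_of_measurable {h : ℝ → ℝ} (hm : Measurable h)
    (hh : ∀ u, Tendsto (fun t => h (t + u) - h t) atTop (𝓝 0)) {ε : ℝ} (hε : 0 < ε) :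
    ∀ᶠ t in atTop, ∀ u ∈ Set.Icc (0 : ℝ) 1, |h (t + u) - h t| < ε := by
  by_contra hcon
  have hfreq : ∀ n : ℕ, ∃ t : ℝ, (n : ℝ) ≤ t ∧ ∃ u ∈ Set.Icc (0 : ℝ) 1,
      ε ≤ |h (t + u) - h t| := by
    intro n
    by_contra! hn
    exact hcon (eventually_atTop.2 ⟨n, fun t ht u hu => hn t ht u hu⟩)
  choose t ht u hu hbad using hfreq
  have key : ∀ a : ℕ → ℝ, Tendsto a atTop atTop →
      Tendsto (fun n => (volume.restrict (Set.Icc (0 : ℝ) 2))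
        {x | ENNReal.ofReal (ε / 2) ≤ edist (h (a n + x) - h (a n)) 0}) atTop (𝓝 0) := by
    intro a ha
    have h1 : TendstoInMeasure (volume.restrict (Set.Icc (0 : ℝ) 2))
        (fun n x => h (a n + x) - h (a n)) atTop (fun _ => (0 : ℝ)) := by
      refine tendstoInMeasure_of_tendsto_ae (fun n => ?_) (ae_of_all _ fun x => ?_)
      · exact ((hm.comp (measurable_const_add _)).sub_const _).aestronglyMeasurable
      · exact (hh x).comp ha
    exact h1 _ (by simpa using hε)
  have htt : Tendsto t atTop atTop := tendsto_atTop_mono ht tendsto_natCast_atTop_atTop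
  -- Pointwise convergence gives convergence in measure along both `t n` and `t n + u n`. A point of
  -- `[0, 1]` in neither exceptional set would contradict `hbad` by the triangle inequality, yet the
  -- two sets have total measure below 1.
  have hst : Tendsto (fun n => t n + u n) atTop atTop :=
    tendsto_atTop_mono (fun n => le_add_of_nonneg_right (hu n).1) htt
  have e1 := (key t htt).eventually (gt_mem_nhds (show (0 : ENNReal) < 1 / 2 by simp))
  have e2 := (key _ hst).eventually (gt_mem_nhds (show (0 : ENNReal) < 1 / 2 by simp))
  obtain ⟨n, h1, h2⟩ := (e1.and e2).exists
  set A := {x | ENNReal.ofReal (ε / 2) ≤ edist (h (t n + x) - h (t n)) 0}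
  set B := {x | ENNReal.ofReal (ε / 2) ≤ edist (h (t n + u n + x) - h (t n + u n)) 0}
  have hcover : Set.Icc (0 : ℝ) 1 ⊆
      ((fun x => x + u n) ⁻¹' (A ∩ Set.Icc (0 : ℝ) 2)) ∪ (B ∩ Set.Icc (0 : ℝ) 2) := by
    intro x hx
    by_contra hnot
    have hx2 : x ∈ Set.Icc (0 : ℝ) 2 := ⟨hx.1, by linarith [hx.2]⟩
    have hx3 : x + u n ∈ Set.Icc (0 : ℝ) 2 :=
      ⟨by linarith [hx.1, (hu n).1], by linarith [hx.2, (hu n).2]⟩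
    have hA : x + u n ∉ A := fun hA => hnot (Or.inl ⟨hA, hx3⟩)
    have hB : x ∉ B := fun hB => hnot (Or.inr ⟨hB, hx2⟩)
    simp only [A, B, Set.mem_ofPred_eq, not_le, edist_dist, dist_zero_right, Real.norm_eq_abs] at hA hB
    have hA' := (ENNReal.ofReal_lt_ofReal_iff (by positivity)).1 hA
    have hB' := (ENNReal.ofReal_lt_ofReal_iff (by positivity)).1 hB
    rw [show t n + u n + x = t n + (x + u n) by ring] at hB'
    have := hbad n
    have h3 := abs_sub_le (h (t n + u n)) (h (t n + (x + u n))) (h (t n))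
    rw [abs_sub_comm (h (t n + u n)) (h (t n + (x + u n)))] at h3
    linarith
  have hle := measure_mono (μ := volume) hcover
  have hAe : volume ((fun x => x + u n) ⁻¹' (A ∩ Set.Icc (0 : ℝ) 2)) =
      volume.restrict (Set.Icc (0 : ℝ) 2) A := by
    rw [measure_preimage_add_right, Measure.restrict_apply' measurableSet_Icc]
  have hBe : volume (B ∩ Set.Icc (0 : ℝ) 2) = volume.restrict (Set.Icc (0 : ℝ) 2) B := by
    rw [Measure.restrict_apply' measurableSet_Icc]
  have hfin := hle.trans (measure_union_le _ _)
  rw [hAe, hBe, Real.volume_Icc] at hfin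
  have hlt := ENNReal.add_lt_add h1 h2
  rw [ENNReal.add_halves] at hlt
  simp only [sub_zero, ENNReal.ofReal_one] at hfin
  exact absurd (hfin.trans_lt hlt) (lt_irrefl _)

/-- A measurable function with vanishing increments at infinity is `o(t)` from below. -/
theorem tendsto_add_self_atTop_of_measurable {h : ℝ → ℝ} (hm : Measurable h)
    (hh : ∀ u, Tendsto (fun t => h (t + u) - h t) atTop (𝓝 0)) :
    Tendsto (fun t => t + h t) atTop atTop := by
  obtain ⟨T, hT⟩ := eventually_atTop.1
    (eventually_forall_abs_sub_lt_of_measurable hm hh (ε := 1 / 2) (by norm_num))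
  -- A loss of at most 1/2 per unit step leaves `t + h t` with slope at least 1/2.
  have hstep : ∀ n : ℕ, h T - n / 2 ≤ h (T + n) := by
    intro n
    induction n with
    | zero => simp
    | succ n ih =>
      have := (abs_lt.1 (hT (T + n) (by simp) 1 (by simp))).1
      push_cast
      rw [← add_assoc]
      linarith
  have hlow : ∀ t, T ≤ t → t / 2 + (T / 2 + h T - 1 / 2) ≤ t + h t := by
    intro t ht
    have h1 := Nat.floor_le (sub_nonneg.2 ht)
    have h2 := Nat.lt_floor_add_one (t - T)
    have h3 := (abs_lt.1 (hT (T + ⌊t - T⌋₊) (by simp) (t - T - ⌊t - T⌋₊)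
      ⟨by linarith, by linarith⟩)).1
    have h4 := hstep ⌊t - T⌋₊
    rw [show T + (⌊t - T⌋₊ : ℝ) + (t - T - ⌊t - T⌋₊) = t by ring] at h3
    linarith
  refine tendsto_atTop_mono' _ (eventually_atTop.2 ⟨T, hlow⟩) ?_
  exact tendsto_atTop_add_const_right _ _ (tendsto_id.atTop_div_const (by norm_num))

namespace IsSlowlyVarying

variable {L : ℝ → ℝ}

theorem tendsto_log_exp_sub (hL : IsSlowlyVarying L) (u : ℝ) :
    Tendsto (fun t => Real.log (L (Real.exp (t + u))) - Real.log (L (Real.exp t))) atTop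
      (𝓝 0) := by
  have h1 := (hL.tendsto_ratio (Real.exp u) (Real.exp_pos u)).comp Real.tendsto_exp_atTop
  have h2 := h1.log one_ne_zero
  rw [Real.log_one] at h2
  refine h2.congr' ?_
  have hpos := Real.tendsto_exp_atTop.eventually hL.eventually_pos
  have hpos' := (tendsto_atTop_add_const_right atTop u tendsto_id).eventually hpos
  filter_upwards [hpos, hpos'] with t h3 h4
  simp only [id] at h4
  simp only [Function.comp]
  rw [show Real.exp u * Real.exp t = Real.exp (t + u) by rw [add_comm, Real.exp_add],
    Real.log_div h4.ne' h3.ne']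

theorem measurable_log_exp (hL : IsSlowlyVarying L) :
    Measurable fun t => Real.log (L (Real.exp t)) :=
  Real.measurable_log.comp (hL.measurable.comp Real.measurable_exp)

theorem tendsto_mul_self_atTop (hL : IsSlowlyVarying L) :
    Tendsto (fun x => x * L x) atTop atTop := by
  have h1 := tendsto_add_self_atTop_of_measurable hL.measurable_log_exp hL.tendsto_log_exp_sub
  have h2 := Real.tendsto_exp_atTop.comp (h1.comp Real.tendsto_log_atTop)
  refine h2.congr' ?_
  filter_upwards [hL.eventually_pos, eventually_gt_atTop 0] with x h3 h4
  simp only [Function.comp]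
  rw [Real.exp_add, Real.exp_log h4, Real.exp_log h3]

/-- A slowly varying function preserves asymptotic equivalence of arguments. -/
theorem isEquivalent_comp (hL : IsSlowlyVarying L) {α : Type*} {l : Filter α} {y z : α → ℝ}
    (hyz : y ~[l] z) (hz : Tendsto z l atTop) :
    (fun a => L (y a)) ~[l] fun a => L (z a) := by
  have hy : Tendsto y l atTop := hyz.symm.tendsto_atTop hz
  have hr : Tendsto (fun a => y a / z a) l (𝓝 1) :=
    (isEquivalent_iff_tendsto_one ((hz.eventually_ne_atTop 0))).1 hyz
  have hrl := hr.log one_ne_zero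
  rw [Real.log_one] at hrl
  have hly := Real.tendsto_log_atTop.comp hy
  have hlz := Real.tendsto_log_atTop.comp hz
  have hpy := hy.eventually hL.eventually_pos
  have hpz := hz.eventually hL.eventually_pos
  have hd : Tendsto (fun a => Real.log (L (y a)) - Real.log (L (z a))) l (𝓝 0) := by
    rw [Metric.tendsto_nhds]
    intro ε hε
    have hu := eventually_forall_abs_sub_lt_of_measurable hL.measurable_log_exp
      hL.tendsto_log_exp_sub hε
    filter_upwards [hly.eventually hu, hlz.eventually hu,
      hrl.eventually (Metric.ball_mem_nhds 0 one_pos), hy.eventually_gt_atTop 0,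
      hz.eventually_gt_atTop 0] with a h1 h2 h3 h4 h5
    simp only [Function.comp] at h1 h2
    rw [Real.dist_eq, sub_zero, Real.log_div h4.ne' h5.ne', abs_lt] at h3
    rw [Real.dist_eq, sub_zero]
    -- The uniform bound covers only shifts in `[0, 1]`, so it is based at the smaller logarithm.
    rcases le_total (Real.log (y a)) (Real.log (z a)) with h | h
    · have := h1 (Real.log (z a) - Real.log (y a)) ⟨by linarith, by linarith⟩
      rwa [add_sub_cancel, Real.exp_log h4, Real.exp_log h5, abs_sub_comm] at this
    · have := h2 (Real.log (y a) - Real.log (z a)) ⟨by linarith, by linarith⟩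
      rwa [add_sub_cancel, Real.exp_log h4, Real.exp_log h5] at this
  refine (isEquivalent_iff_tendsto_one (hpz.mono fun a h => h.ne')).2 ?_
  have he := (Real.continuous_exp.tendsto 0).comp hd
  rw [Real.exp_zero] at he
  refine he.congr' ?_
  filter_upwards [hpy, hpz] with a h1 h2
  simp only [Function.comp, Pi.div_apply]
  rw [Real.exp_sub, Real.exp_log h1, Real.exp_log h2]

theorem ellZero {ℓ : ℝ → ℝ} (hℓ : IsSlowlyVarying ℓ) {β : ℝ} (hβ : 0 ≤ β) :
    IsSlowlyVarying (ellZero β ℓ) where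
  measurable := (hℓ.measurable.div_const _).pow_const _
  eventually_pos := by
    filter_upwards [hℓ.eventually_pos] with x hx
    exact Real.rpow_pos_of_pos (by positivity) _
  tendsto_ratio c hc := by
    have h1 := (hℓ.tendsto_ratio c hc).rpow_const (p := 1 / (β + 1)) (Or.inl one_ne_zero)
    rw [Real.one_rpow] at h1
    refine h1.congr' ?_
    have hcx : Tendsto (fun x : ℝ => c * x) atTop atTop := tendsto_id.const_mul_atTop hc
    filter_upwards [hℓ.eventually_pos, hcx.eventually hℓ.eventually_pos] with x h2 h3
    have hβ' : 0 < β + 1 := by positivity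
    rw [_root_.ellZero, _root_.ellZero, ← Real.div_rpow (by positivity) (by positivity),
      div_div_div_cancel_right₀ hβ'.ne']

end IsSlowlyVarying

/-! ### The counting function as a generalized inverse. -/

/-- Such a set is the interval `Set.Icc 1 T.ncard`. -/
theorem mem_iff_le_ncard_of_finite {T : Set ℕ} (hT : T.Finite) (hpos : ∀ k ∈ T, 1 ≤ k)
    (hdown : ∀ k ∈ T, ∀ j, 1 ≤ j → j ≤ k → j ∈ T) {k : ℕ} (hk : 1 ≤ k) :
    k ∈ T ↔ k ≤ T.ncard := by
  have hI : ∀ m : ℕ, (Set.Icc 1 m).ncard = m := by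
    intro m
    rw [← Finset.coe_Icc, Set.ncard_coe_finset]
    simp
  constructor
  · intro h
    have : Set.Icc 1 k ⊆ T := fun j hj => hdown k h j hj.1 hj.2
    simpa [hI] using Set.ncard_le_ncard this hT
  · intro h
    by_contra hn
    have : T ⊆ Set.Icc 1 (k - 1) := by
      intro j hj
      refine ⟨hpos j hj, ?_⟩
      by_contra hlt
      exact hn (hdown j hj k hk (by omega))
    have := Set.ncard_le_ncard this (Set.finite_Icc _ _)
    rw [hI] at this
    omega

/-- Up to an additive constant, the counting function of an eventually nonincreasing distribution
is the generalized inverse of its tail. -/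
theorem exists_inverse_countingFn {p : ℕ → ℝ} (hp : IsBoxDistribution p)
    (hmono : EventuallyNonincreasing p) :
    ∃ (N z : ℕ) (n : ℝ → ℕ), AntitoneOn p (Set.Ici N) ∧ (∀ k, N ≤ k → 0 < p k) ∧
      Tendsto p atTop (𝓝 0) ∧ Tendsto n atTop atTop ∧
      ∀ᶠ x in atTop, countingFn p x + z = n x ∧ ∀ k, N ≤ k → (k ≤ n x ↔ 1 / x ≤ p k) := by
  obtain ⟨N₀, hN₀⟩ := hmono
  set N := N₀ + 1
  have hanti : AntitoneOn p (Set.Ici N) :=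
    antitoneOn_nat_Ici_of_succ_le fun k hk => hN₀ k (by omega)
  have hpos : ∀ k, N ≤ k → 0 < p k := by
    intro k hk
    by_contra hle
    refine hp.infinite_pos ((Set.finite_Iio k).subset fun j hj => ?_)
    by_contra hjk
    have hjk : k ≤ j := not_lt.1 hjk
    have := hanti (Set.mem_Ici.2 hk) (Set.mem_Ici.2 (hk.trans hjk)) hjk
    linarith [hj.2]
  have hlim : Tendsto p atTop (𝓝 0) :=
    (tendsto_add_atTop_iff_nat 1).1 hp.hasSum.summable.tendsto_atTop_zero
  -- Zeros of `p` before `N` are never counted. Adding them fills the gaps, so for large `x` the set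
  -- is an initial segment.
  set Z : Set ℕ := {k | 1 ≤ k ∧ k < N ∧ p k = 0}
  set n : ℝ → ℕ := fun x => {k : ℕ | 1 ≤ k ∧ 1 / x ≤ p k}.ncard + Z.ncard
  have hZfin : Z.Finite := (Set.finite_Iio N).subset fun k hk => hk.2.1
  have hsmall : ∀ᶠ x : ℝ in atTop, ∀ k ∈ Finset.range N, 0 < p k → 1 / x ≤ p k := by
    rw [eventually_all_finset]
    intro k _
    by_cases hk : 0 < p k
    · filter_upwards [eventually_ge_atTop (1 / p k), eventually_gt_atTop 0] with x hx hx0 _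
      rw [div_le_iff₀ hx0]
      rwa [div_le_iff₀ hk, mul_comm] at hx
    · simp [hk]
  have hmain : ∀ᶠ x in atTop, countingFn p x + Z.ncard = n x ∧
      ∀ k, N ≤ k → (k ≤ n x ↔ 1 / x ≤ p k) := by
    filter_upwards [hsmall, eventually_gt_atTop 0] with x hx hx0
    refine ⟨by simp [countingFn, n], ?_⟩
    set S : Set ℕ := {k | 1 ≤ k ∧ 1 / x ≤ p k}
    have hx1 : 0 < 1 / x := by positivity
    have hSfin : S.Finite := by
      obtain ⟨K, hK⟩ := eventually_atTop.1 (hlim.eventually (gt_mem_nhds hx1))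
      refine (Set.finite_Iio K).subset fun k hk => ?_
      by_contra hkK
      exact absurd hk.2 (not_le.2 (hK k (not_lt.1 hkK)))
    have hdisj : Disjoint S Z := by
      rw [Set.disjoint_left]
      intro k hk hk'
      have h1 := hk.2
      rw [hk'.2.2] at h1
      linarith
    have hcard : (S ∪ Z).ncard = n x := Set.ncard_union_eq hdisj hSfin hZfin
    have hmem : ∀ k, 1 ≤ k → (k ∈ S ∪ Z ↔ k < N ∨ 1 / x ≤ p k) := by
      intro k hk
      constructor
      · rintro (h | h)
        · exact Or.inr h.2
        · exact Or.inl h.2.1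
      · rintro (h | h)
        · rcases (hp.nonneg k hk).eq_or_lt with h0 | h0
          · exact Or.inr ⟨hk, h, h0.symm⟩
          · exact Or.inl ⟨hk, hx k (Finset.mem_range.2 h) h0⟩
        · exact Or.inl ⟨hk, h⟩
    have hone : ∀ k ∈ S ∪ Z, 1 ≤ k := by
      rintro k (h | h) <;> exact h.1
    intro k hk
    rw [← hcard, ← mem_iff_le_ncard_of_finite (hSfin.union hZfin) hone ?_ (by omega : 1 ≤ k),
      hmem k (by omega)]
    · constructor
      · rintro (h | h)
        · omega
        · exact h
      · exact Or.inr
    · intro j hj i hi hij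
      rw [hmem i hi]
      rcases (hmem j (hone j hj)).1 hj with h | h
      · left; omega
      · by_cases hiN : i < N
        · exact Or.inl hiN
        · have hiN : N ≤ i := not_lt.1 hiN
          exact Or.inr (h.trans (hanti (Set.mem_Ici.2 hiN) (Set.mem_Ici.2 (hiN.trans hij)) hij))
  refine ⟨N, Z.ncard, n, hanti, hpos, hlim, ?_, hmain⟩
  rw [tendsto_atTop]
  intro m
  have hk := hpos (max m N) (le_max_right _ _)
  filter_upwards [hmain, eventually_ge_atTop (1 / p (max m N)), eventually_gt_atTop 0]
    with x h1 h2 h3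
  refine (le_max_left m N).trans ((h1.2 _ (le_max_right _ _)).2 ?_)
  rw [div_le_iff₀ h3]
  rwa [div_le_iff₀ hk, mul_comm] at h2

theorem countingFn_isEquivalent_of_add_const {p : ℕ → ℝ} {z : ℕ} {n : ℝ → ℕ}
    (hn : Tendsto n atTop atTop) (h : ∀ᶠ x in atTop, countingFn p x + z = n x) :
    countingFn p ~[atTop] fun x => (n x : ℝ) := by
  have hn' : Tendsto (fun x => (n x : ℝ)) atTop atTop := tendsto_natCast_atTop_atTop.comp hn
  have hz : (fun _ : ℝ => (z : ℝ)) =o[atTop] fun x => (n x : ℝ) :=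
    isLittleO_const_left.2 (Or.inr (tendsto_norm_atTop_atTop.comp hn'))
  refine (IsEquivalent.refl.sub_isLittleO hz).congr_left ?_
  filter_upwards [h] with x hx
  simp only [Pi.sub_apply]
  linarith

/-! ### Part (a): inversion by de Bruijn conjugates. -/

namespace IsDeBruijnConjugate

variable {L Lc : ℝ → ℝ}

theorem symm (h : IsDeBruijnConjugate L Lc) (hL : IsSlowlyVarying L) :
    IsDeBruijnConjugate Lc L :=
  ⟨hL, h.tendsto_right, h.tendsto_left⟩

/-- Conjugacy settles `c = 1`; slow variation of `L` lets the factor `c` pass through. -/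
theorem tendsto_div (h : IsDeBruijnConjugate L Lc) (hL : IsSlowlyVarying L) {c : ℝ} (hc : 0 < c) :
    Tendsto (fun y => c * (y * Lc y) * L (c * (y * Lc y)) / y) atTop (𝓝 c) := by
  have hw := h.slowlyVarying.tendsto_mul_self_atTop
  have h1 := ((hL.tendsto_ratio c hc).comp hw).mul h.tendsto_right
  have h2 := h1.const_mul c
  rw [mul_one, mul_one] at h2
  refine h2.congr' ?_
  filter_upwards [hw.eventually hL.eventually_pos, eventually_gt_atTop 0] with y h3 h4
  simp only [Function.comp]
  field_simp

end IsDeBruijnConjugate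

theorem countingFn_isEquivalent {p : ℕ → ℝ} (hp : IsBoxDistribution p)
    (hmono : EventuallyNonincreasing p) {b : ℝ} {L Lc : ℝ → ℝ} (hb : 0 < b)
    (hL : IsSlowlyVarying L) (hLc : IsDeBruijnConjugate L Lc)
    (h : negLogFloor p ~[atTop] fun x => x ^ (1 / b) * L (x ^ (1 / b))) :
    countingFn p ~[atTop] fun x => (Real.log x) ^ b * (Lc (Real.log x)) ^ b := by
  obtain ⟨N, z, n, hanti, hpos, hlim, hn, hinv⟩ := exists_inverse_countingFn hp hmono
  refine (countingFn_isEquivalent_of_add_const hn (hinv.mono fun x hx => hx.1)).trans ?_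
  set w : ℝ → ℝ := fun x => Real.log x * Lc (Real.log x)
  have hw : Tendsto w atTop atTop :=
    hLc.slowlyVarying.tendsto_mul_self_atTop.comp Real.tendsto_log_atTop
  have hwb : Tendsto (fun x => w x ^ b) atTop atTop := (tendsto_rpow_atTop hb).comp hw
  have htc : ∀ c : ℝ, 0 < c → Tendsto (fun x => (c * w x) ^ b) atTop atTop := fun c hc =>
    (tendsto_rpow_atTop hb).comp (hw.const_mul_atTop hc)
  have hratio : ∀ c : ℝ, 0 < c →
      Tendsto (fun x => -Real.log (p ⌊(c * w x) ^ b⌋₊) / Real.log x) atTop (𝓝 c) := by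
    intro c hc
    have h1 := (hLc.tendsto_div hL hc).comp Real.tendsto_log_atTop
    have h2 := h.comp_tendsto (htc c hc)
    have h3 : ((fun x => -Real.log (p ⌊(c * w x) ^ b⌋₊)) / Real.log) ~[atTop]
        ((fun x => c * w x * L (c * w x)) / Real.log) := by
      refine IsEquivalent.div (h2.congr_right ?_) IsEquivalent.refl
      filter_upwards [hw.eventually_gt_atTop 0] with x hx
      simp only [Function.comp]
      rw [← Real.rpow_mul (by positivity), mul_one_div_cancel hb.ne', Real.rpow_one]
    exact h3.symm.tendsto_nhds h1
  have hNfloor : ∀ c : ℝ, 0 < c → ∀ᶠ x in atTop, N ≤ ⌊(c * w x) ^ b⌋₊ := fun c hc =>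
    (tendsto_nat_floor_atTop.comp (htc c hc)).eventually_ge_atTop N
  -- The `+ 1` pays for the floor; it is absorbed because `w x ^ b → ∞`.
  have hlower : ∀ c : ℝ, 0 < c → c < 1 → ∀ᶠ x in atTop, c ^ b * w x ^ b < n x + 1 := by
    intro c hc hc1
    filter_upwards [hinv, hNfloor c hc, (hratio c hc).eventually (gt_mem_nhds hc1),
      Real.tendsto_log_atTop.eventually_gt_atTop 0, eventually_gt_atTop 0,
      hw.eventually_gt_atTop 0] with x h1 h2 h3 h4 h5 h6
    rw [div_lt_one h4, neg_lt, ← Real.log_inv, Real.log_lt_log_iff (by positivity) (hpos _ h2),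
      ← one_div] at h3
    have h7 := (h1.2 _ h2).2 h3.le
    have h8 := Nat.lt_floor_add_one ((c * w x) ^ b)
    rw [← Real.mul_rpow hc.le h6.le]
    have h9 : ((⌊(c * w x) ^ b⌋₊ : ℕ) : ℝ) ≤ n x := by exact_mod_cast h7
    linarith
  have hupper : ∀ c : ℝ, 1 < c → ∀ᶠ x in atTop, (n x : ℝ) < c ^ b * w x ^ b := by
    intro c hc1
    have hc : 0 < c := by linarith
    filter_upwards [hinv, hNfloor c hc, (hratio c hc).eventually (lt_mem_nhds hc1),
      Real.tendsto_log_atTop.eventually_gt_atTop 0, eventually_gt_atTop 0,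
      hw.eventually_gt_atTop 0] with x h1 h2 h3 h4 h5 h6
    rw [one_lt_div h4, lt_neg, ← Real.log_inv, Real.log_lt_log_iff (hpos _ h2) (by positivity),
      ← one_div] at h3
    have h7 := not_le.1 fun hle => absurd ((h1.2 _ h2).1 hle) (not_le.2 h3)
    have h8 := Nat.floor_le (show 0 ≤ (c * w x) ^ b by positivity)
    rw [← Real.mul_rpow hc.le h6.le]
    have h9 : (n x : ℝ) < ((⌊(c * w x) ^ b⌋₊ : ℕ) : ℝ) := by exact_mod_cast h7
    linarith
  have hcont : Tendsto (fun c : ℝ => c ^ b) (𝓝 1) (𝓝 1) := by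
    have := Real.continuousAt_rpow_const 1 b (Or.inl one_ne_zero)
    rwa [ContinuousAt, Real.one_rpow] at this
  have hmain : (fun x => (n x : ℝ)) ~[atTop] fun x => w x ^ b := by
    refine (isEquivalent_iff_tendsto_one (hwb.eventually_ne_atTop 0)).2 ?_
    refine tendsto_order.2 ⟨fun a ha => ?_, fun a ha => ?_⟩
    · obtain ⟨c, ⟨hca, hc0⟩, hc1⟩ := ((((hcont.eventually (lt_mem_nhds ha)).and
        (lt_mem_nhds (zero_lt_one' ℝ))).filter_mono nhdsWithin_le_nhds).and
          (self_mem_nhdsWithin (s := Set.Iio (1 : ℝ)))).exists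
      filter_upwards [hlower c hc0 hc1, hwb.eventually_gt_atTop 0,
        (hwb.const_mul_atTop (sub_pos.2 hca)).eventually_ge_atTop 1] with x h1 h2 h3
      rw [Pi.div_apply, lt_div_iff₀ h2]
      linarith
    · obtain ⟨c, hca, hc1⟩ := (((hcont.eventually (gt_mem_nhds ha)).filter_mono
        nhdsWithin_le_nhds).and (self_mem_nhdsWithin (s := Set.Ioi (1 : ℝ)))).exists
      filter_upwards [hupper c hc1, hwb.eventually_gt_atTop 0] with x h1 h2
      rw [Pi.div_apply, div_lt_iff₀ h2]
      exact h1.trans (mul_lt_mul_of_pos_right hca h2)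
  refine hmain.congr_right ?_
  filter_upwards [Real.tendsto_log_atTop.eventually hLc.slowlyVarying.eventually_pos,
    Real.tendsto_log_atTop.eventually_gt_atTop 0] with x h1 h2
  exact Real.mul_rpow h2.le h1.le

theorem ellZero_rpow {β y : ℝ} {ℓ : ℝ → ℝ} (hβ : 0 ≤ β) (hy : 0 ≤ ℓ y) :
    ellZero β ℓ y ^ (β + 1) = (β + 1)⁻¹ * ℓ y := by
  have hβ' : 0 < β + 1 := by positivity
  rw [ellZero, ← Real.rpow_mul (by positivity), one_div_mul_cancel hβ'.ne', Real.rpow_one,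
    div_eq_inv_mul]

/-- Conjugacy is symmetric: `ℓc` plays the role of `L`, and its conjugate is `ellZero β ℓ`. -/
theorem countingFn_isEquivalent_ellZero {p : ℕ → ℝ} (hp : IsBoxDistribution p)
    (hmono : EventuallyNonincreasing p) {β : ℝ} {ℓ ℓc : ℝ → ℝ} (hβ : 0 ≤ β)
    (hℓ : IsSlowlyVarying ℓ) (hℓc : IsDeBruijnConjugate (ellZero β ℓ) ℓc)
    (h : negLogFloor p ~[atTop] fun x => x ^ (1 / (β + 1)) * ℓc (x ^ (1 / (β + 1)))) :
    countingFn p ~[atTop] fun x => (β + 1)⁻¹ * (Real.log x) ^ (β + 1) * ℓ (Real.log x) := by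
  have hβ' : 0 < β + 1 := by positivity
  refine (countingFn_isEquivalent hp hmono hβ' hℓc.slowlyVarying (hℓc.symm (hℓ.ellZero hβ))
    h).congr_right ?_
  filter_upwards [Real.tendsto_log_atTop.eventually hℓ.eventually_pos] with x hx
  rw [ellZero_rpow hβ hx.le]
  ring

/-! ### Part (b): increments of the inverse. -/

/-- The inverse of a step function in de Haan's class `Γ` belongs to de Haan's class `Π`. -/
theorem tendsto_inverse_increment_div {p : ℕ → ℝ} {N : ℕ} {n : ℝ → ℕ}
    (hanti : AntitoneOn p (Set.Ici N)) (hpos : ∀ k, N ≤ k → 0 < p k)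
    (hlim : Tendsto p atTop (𝓝 0)) (hn : Tendsto n atTop atTop)
    (hinv : ∀ᶠ x in atTop, ∀ k, N ≤ k → (k ≤ n x ↔ 1 / x ≤ p k)) {g : ℝ → ℝ}
    (hg : ∀ t, 0 ≤ g t)
    (hs : ∀ u : ℝ, Tendsto (fun t => invFloor p (t + u * g t) / invFloor p t) atTop
      (𝓝 (Real.exp u))) {c : ℝ} (hc : 0 < c) :
    Tendsto (fun x => ((n (c * x) : ℝ) - n x) / g (n x)) atTop (𝓝 (Real.log c)) := by
  have hs' : ∀ u : ℝ, Tendsto (fun m : ℕ => p m / p ⌊(m : ℝ) + u * g m⌋₊) atTop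
      (𝓝 (Real.exp u)) := by
    intro u
    refine ((hs u).comp tendsto_natCast_atTop_atTop).congr fun m => ?_
    simp only [Function.comp, invFloor, Nat.floor_natCast]
    rw [div_div_div_eq, one_mul, mul_one]
  -- If `g m < C`, a shift by `g m / (|C| + 1)` does not change the floor, so the ratio is 1 instead
  -- of being near `exp (1 / (|C| + 1)) > 1`.
  have hg_atTop : Tendsto (fun m : ℕ => g m) atTop atTop := by
    refine tendsto_atTop.2 fun C => ?_
    have hC : 0 < |C| + 1 := by positivity
    have h1 : 1 < Real.exp (1 / (|C| + 1)) := Real.one_lt_exp_iff.2 (by positivity)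
    filter_upwards [(hs' _).eventually (lt_mem_nhds h1), eventually_ge_atTop N] with m h2 h3
    by_contra! hlt
    have h4 : ⌊(m : ℝ) + 1 / (|C| + 1) * g m⌋₊ = m := by
      have h5 : 1 / (|C| + 1) * g m < 1 := by
        rw [one_div_mul_eq_div, div_lt_one hC]
        linarith [le_abs_self C]
      have h6 : 0 ≤ 1 / (|C| + 1) * g m := mul_nonneg (by positivity) (hg _)
      rw [Nat.floor_eq_iff (by positivity)]
      constructor <;> linarith
    rw [h4, div_self (hpos m h3).ne'] at h2
    exact lt_irrefl _ h2
  -- At a fixed index `k < N` the ratio `p m / p k` tends to 0, not to `exp u`. This includes `p k =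
  -- 0`, where the quotient is 0, and negative arguments, whose floor is 0.
  have hNfloor : ∀ u : ℝ, ∀ᶠ m : ℕ in atTop, N ≤ ⌊(m : ℝ) + u * g m⌋₊ := by
    intro u
    have h1 : ∀ᶠ m in atTop, ∀ k ∈ Finset.range N, p m / p k < Real.exp u / 2 := by
      rw [eventually_all_finset]
      intro k _
      have h2 := hlim.div_const (p k)
      rw [zero_div] at h2
      exact h2.eventually (gt_mem_nhds (by positivity))
    filter_upwards [h1, (hs' u).eventually (lt_mem_nhds (half_lt_self (Real.exp_pos u)))]
      with m h2 h3
    by_contra! hlt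
    exact lt_asymm h3 (h2 _ (Finset.mem_range.2 hlt))
  have hcx : Tendsto (fun x : ℝ => c * x) atTop atTop := tendsto_id.const_mul_atTop hc
  have hgn : Tendsto (fun x => g (n x)) atTop atTop := hg_atTop.comp hn
  have hlower : ∀ u, u < Real.log c → ∀ᶠ x in atTop, u * g (n x) - 1 < (n (c * x) : ℝ) - n x := by
    intro u hu
    have h1 : Real.exp u < c := (Real.lt_log_iff_exp_lt hc).1 hu
    filter_upwards [hn.eventually (hNfloor u), hn.eventually ((hs' u).eventually (gt_mem_nhds h1)),
      hinv, hcx.eventually hinv, hn.eventually_ge_atTop N, eventually_gt_atTop 0]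
      with x h2 h3 h4 h5 h6 h7
    rw [div_lt_iff₀ (hpos _ h2)] at h3
    have h8 := (h4 _ h6).1 le_rfl
    have h9 := (h5 _ h2).2 <| by
      rw [div_le_iff₀ h7] at h8
      rw [div_le_iff₀ (by positivity)]
      nlinarith
    have h10 := Nat.lt_floor_add_one ((n x : ℝ) + u * g (n x))
    have h11 : ((⌊(n x : ℝ) + u * g (n x)⌋₊ : ℕ) : ℝ) ≤ n (c * x) := by exact_mod_cast h9
    linarith
  have hupper : ∀ u, Real.log c < u → ∀ᶠ x in atTop, (n (c * x) : ℝ) - n x ≤ u * g (n x) := by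
    intro u hu
    -- Only `p (n x + 1) < 1 / x` is known, not a bound on `p (n x)`. A shift by `δ / 2 * g` passes
    -- `n x + 1` at the cost of a factor below `exp δ`, which fits since `log c + δ < u`.
    set δ := (u - Real.log c) / 2
    have hδ : 0 < δ := by simp only [δ]; linarith
    have h1 : c * Real.exp δ < Real.exp u := by
      rw [← Real.exp_log hc, ← Real.exp_add, Real.exp_lt_exp]
      simp only [δ]
      linarith
    have h1' : Real.exp (δ / 2) < Real.exp δ := Real.exp_lt_exp.2 (by linarith)
    filter_upwards [hn.eventually (hNfloor u), hn.eventually ((hs' u).eventually (lt_mem_nhds h1)),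
      hn.eventually ((hs' (δ / 2)).eventually (gt_mem_nhds h1')),
      (hgn.const_mul_atTop (half_pos hδ)).eventually_ge_atTop 1,
      hinv, hcx.eventually hinv, hn.eventually_ge_atTop N, eventually_gt_atTop 0]
      with x h2 h3 h4 h5 h6 h7 h8 h9
    have hfl : n x + 1 ≤ ⌊(n x : ℝ) + δ / 2 * g (n x)⌋₊ := by
      rw [Nat.le_floor_iff' (Nat.succ_ne_zero _)]
      push_cast
      linarith
    have hN1 : N ≤ n x + 1 := by omega
    have hp1 := hanti (Set.mem_Ici.2 hN1) (Set.mem_Ici.2 (hN1.trans hfl)) hfl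
    have hp2 : p (n x + 1) < 1 / x := by
      by_contra! hle
      have := (h6 _ hN1).2 hle
      omega
    rw [div_lt_iff₀ (hpos _ (hN1.trans hfl))] at h4
    rw [lt_div_iff₀ (hpos _ h2)] at h3
    have hp3 : c * p ⌊(n x : ℝ) + u * g (n x)⌋₊ < 1 / x := by
      refine lt_of_lt_of_le ?_ (hp1.trans hp2.le)
      have := h3.trans h4
      rw [mul_comm c, mul_assoc, mul_comm] at this
      exact (mul_lt_mul_iff_of_pos_left (Real.exp_pos δ)).1 (by linarith)
    have hlt : n (c * x) < ⌊(n x : ℝ) + u * g (n x)⌋₊ := by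
      by_contra! hle
      have h10 := (h7 _ h2).1 hle
      rw [div_le_iff₀ (by positivity)] at h10
      rw [lt_div_iff₀ h9] at hp3
      linarith
    have h11 := (Nat.le_floor_iff' (Nat.succ_ne_zero _)).1 (Nat.succ_le_of_lt hlt)
    push_cast at h11
    linarith
  refine tendsto_order.2 ⟨fun a ha => ?_, fun a ha => ?_⟩
  · obtain ⟨u, hau, hu⟩ := exists_between ha
    filter_upwards [hlower u hu, hgn.eventually_gt_atTop 0,
      (hgn.const_mul_atTop (sub_pos.2 hau)).eventually_ge_atTop 1] with x h1 h2 h3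
    rw [lt_div_iff₀ h2]
    linarith
  · obtain ⟨u, hu, hua⟩ := exists_between ha
    filter_upwards [hupper u hu, hgn.eventually_gt_atTop 0] with x h1 h2
    rw [div_lt_iff₀ h2]
    exact h1.trans_lt (mul_lt_mul_of_pos_right hua h2)

/-! ### Part (b): the auxiliary function along the inverse. -/

theorem Asymptotics.IsEquivalent.rpow_of_eventually_nonneg {α : Type*} {u v : α → ℝ}
    {l : Filter α} (h : u ~[l] v) (hv : 0 ≤ᶠ[l] v) {r : ℝ} : u ^ r ~[l] v ^ r := by
  have habs : v =ᶠ[l] fun a => |v a| := hv.mono fun a ha => (abs_of_nonneg ha).symm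
  refine ((h.congr_right habs).rpow fun a => abs_nonneg (v a)).congr_right ?_
  filter_upwards [habs] with a ha
  simp only [Pi.pow_apply]
  rw [← ha]

/-- The root `n ^ (1 / (β + 1))` is equivalent to a constant times `v (log x)`. Slow variation
discards the constant and `hℓℓ` turns `ℓ (v (log x))` into `ℓ (log x)`; the exponents of `ℓ` then
add up to 1. -/
theorem isEquivalent_auxiliary_comp {β : ℝ} {ℓ g n : ℝ → ℝ} (hβ : 0 ≤ β)
    (hℓ : IsSlowlyVarying ℓ)
    (hg : g ~[atTop] fun t => (β + 1) ^ (β / (β + 1)) * t ^ (β / (β + 1)) *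
      (ℓ (t ^ (1 / (β + 1)))) ^ (1 / (β + 1)))
    (hℓℓ : (fun t => ℓ (t * (ℓ t) ^ (1 / (β + 1)))) ~[atTop] ℓ)
    (hn : Tendsto n atTop atTop)
    (hnW : n ~[atTop] fun x => (β + 1)⁻¹ * (Real.log x) ^ (β + 1) * ℓ (Real.log x)) :
    (fun x => g (n x)) ~[atTop] fun x => (Real.log x) ^ β * ℓ (Real.log x) := by
  have hβ' : 0 < β + 1 := by positivity
  have hlog := Real.tendsto_log_atTop
  set W : ℝ → ℝ := fun x => (β + 1)⁻¹ * (Real.log x) ^ (β + 1) * ℓ (Real.log x)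
  set v : ℝ → ℝ := fun y => y * (ℓ y) ^ (1 / (β + 1))
  set κ : ℝ := ((β + 1)⁻¹) ^ (1 / (β + 1))
  have hκ : 0 < κ := by positivity
  have hWpos : 0 ≤ᶠ[atTop] W := by
    filter_upwards [hlog.eventually hℓ.eventually_pos, hlog.eventually_gt_atTop 0] with x h1 h2
    simp only [W, Pi.zero_apply]
    positivity
  have hW : ∀ᶠ x in atTop, W x ^ (1 / (β + 1)) = κ * v (Real.log x) := by
    filter_upwards [hlog.eventually hℓ.eventually_pos, hlog.eventually_gt_atTop 0] with x h1 h2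
    simp only [W, κ, v]
    rw [Real.mul_rpow (by positivity) h1.le, Real.mul_rpow (by positivity) (by positivity),
      ← Real.rpow_mul h2.le, mul_one_div_cancel hβ'.ne', Real.rpow_one]
    ring
  have hv : Tendsto v atTop atTop := by
    have h1 := (hℓ.ellZero hβ).tendsto_mul_self_atTop.const_mul_atTop (inv_pos.2 hκ)
    refine h1.congr' ?_
    filter_upwards [hℓ.eventually_pos] with y hy
    simp only [v, κ, ellZero]
    rw [div_eq_inv_mul (ℓ y), Real.mul_rpow (by positivity) hy.le, mul_left_comm y,
      inv_mul_cancel_left₀ hκ.ne']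
  have hκv : Tendsto (fun x => κ * v (Real.log x)) atTop atTop :=
    (hv.comp hlog).const_mul_atTop hκ
  have hroot : (fun x => n x ^ (1 / (β + 1))) ~[atTop] fun x => κ * v (Real.log x) :=
    (hnW.rpow_of_eventually_nonneg hWpos).congr_right hW
  have hℓn : (fun x => ℓ (n x ^ (1 / (β + 1)))) ~[atTop] fun x => ℓ (Real.log x) := by
    refine (hℓ.isEquivalent_comp hroot hκv).trans (IsEquivalent.trans ?_ (hℓℓ.comp_tendsto hlog))
    have h1 := (hℓ.tendsto_ratio κ hκ).comp (hv.comp hlog)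
    exact isEquivalent_of_tendsto_one h1
  have hℓpos : 0 ≤ᶠ[atTop] fun x => ℓ (Real.log x) :=
    (hlog.eventually hℓ.eventually_pos).mono fun x hx => hx.le
  have h1 := ((IsEquivalent.refl (u := fun _ : ℝ => (β + 1) ^ (β / (β + 1)))).mul
    (hnW.rpow_of_eventually_nonneg (r := β / (β + 1)) hWpos)).mul (hℓn.rpow_of_eventually_nonneg (r := 1 / (β + 1)) hℓpos)
  refine (hg.comp_tendsto hn).trans (h1.congr_right ?_)
  filter_upwards [hlog.eventually hℓ.eventually_pos, hlog.eventually_gt_atTop 0] with x h2 h3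
  simp only [Pi.mul_apply, Pi.pow_apply, W]
  rw [Real.mul_rpow (by positivity) h2.le, Real.mul_rpow (by positivity) (by positivity),
    ← Real.rpow_mul h3.le, mul_div_cancel₀ _ hβ'.ne', Real.inv_rpow hβ'.le]
  have h4 : (β + 1) ^ (β / (β + 1)) ≠ 0 := (Real.rpow_pos_of_pos hβ' _).ne'
  have h5 : ℓ (Real.log x) ^ (β / (β + 1)) * ℓ (Real.log x) ^ (1 / (β + 1)) = ℓ (Real.log x) := by
    rw [← Real.rpow_add h2, ← add_div, div_self hβ'.ne', Real.rpow_one]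
  field_simp
  exact h5
theorem proposition4p1 (p : ℕ → ℝ) (hp : IsBoxDistribution p)
    (hmono : EventuallyNonincreasing p) :
    -- Part (a), first claim
    (∀ (b : ℝ) (L Lc : ℝ → ℝ), 0 < b → IsSlowlyVarying L → IsDeBruijnConjugate L Lc →
      negLogFloor p ~[atTop] (fun x => x ^ (1 / b) * L (x ^ (1 / b))) →
      countingFn p ~[atTop] (fun x => (Real.log x) ^ b * (Lc (Real.log x)) ^ b)) ∧
    -- Part (a), the particular case
    (∀ (β : ℝ) (ℓ ℓc : ℝ → ℝ), 0 ≤ β → IsSlowlyVarying ℓ →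
      IsDeBruijnConjugate (ellZero β ℓ) ℓc →
      negLogFloor p ~[atTop] (fun x => x ^ (1 / (β + 1)) * ℓc (x ^ (1 / (β + 1)))) →
      countingFn p ~[atTop]
        (fun x => (β + 1)⁻¹ * (Real.log x) ^ (β + 1) * ℓ (Real.log x))) ∧
    -- Part (b)
    (∀ (β : ℝ) (ℓ ℓc g : ℝ → ℝ), 0 ≤ β → IsSlowlyVarying ℓ →
      IsDeBruijnConjugate (ellZero β ℓ) ℓc →
      negLogFloor p ~[atTop] (fun x => x ^ (1 / (β + 1)) * ℓc (x ^ (1 / (β + 1)))) →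
      Measurable g → (∀ t, 0 ≤ g t) →
      g ~[atTop] (fun t => (β + 1) ^ (β / (β + 1)) * t ^ (β / (β + 1)) *
        (ℓ (t ^ (1 / (β + 1)))) ^ (1 / (β + 1))) →
      (∀ u : ℝ, Tendsto (fun t => invFloor p (t + u * g t) / invFloor p t) atTop
        (𝓝 (Real.exp u))) →
      (fun t => ℓ (t * (ℓ t) ^ (1 / (β + 1)))) ~[atTop] ℓ →
      ∀ c : ℝ, 0 < c →
        Tendsto (fun t => (countingFn p (c * t) - countingFn p t) /
          ((Real.log t) ^ β * ℓ (Real.log t))) atTop (𝓝 (Real.log c))) := by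
  refine ⟨fun b L Lc hb hL hLc h => countingFn_isEquivalent hp hmono hb hL hLc h,
    fun β ℓ ℓc hβ hℓ hℓc h => countingFn_isEquivalent_ellZero hp hmono hβ hℓ hℓc h, ?_⟩
  intro β ℓ ℓc g hβ hℓ hℓc h _ hg0 hg hs hℓℓ c hc
  have hρ := countingFn_isEquivalent_ellZero hp hmono hβ hℓ hℓc h
  obtain ⟨N, z, n, hanti, hpos, hlim, hn, hinv⟩ := exists_inverse_countingFn hp hmono
  have hnρ := countingFn_isEquivalent_of_add_const hn (hinv.mono fun x hx => hx.1)
  have hgn := isEquivalent_auxiliary_comp hβ hℓ hg hℓℓ (tendsto_natCast_atTop_atTop.comp hn)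
    (hnρ.symm.trans hρ)
  have hinc := tendsto_inverse_increment_div hanti hpos hlim hn (hinv.mono fun x hx => hx.2)
    hg0 hs hc
  have hequiv := (IsEquivalent.refl (u := fun x => (n (c * x) : ℝ) - n x)).div hgn
  refine (hequiv.tendsto_nhds hinc).congr' ?_
  have hcx : Tendsto (fun x : ℝ => c * x) atTop atTop := tendsto_id.const_mul_atTop hc
  filter_upwards [hinv, hcx.eventually hinv] with x h1 h2
  simp only [Pi.div_apply]
  -- The additive constant `z` cancels in the difference.
  rw [← h1.1, ← h2.1, add_sub_add_right_eq_sub]
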